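/- Consider $J\ge 1$ items with order-up-to levels $Q_j\in\mathbb Z$, $Q_j>0$, independent Poisson demands of rates $\lambda_j>0$, unit stockout costs $b_j\ge 0$, a fixed replenishment cost $A$ and a lead time $\tau\ge 0$. Put $\Lambda=\sum_j\lambda_j$, $p_j=\lambda_j/\Lambda$, and let $D_j$ be Poisson with mean $\lambda_j\tau$. The state space is $\mathcal S=\{\boldsymbol i\in\mathbb Z^J: i_j\le Q_j\ \forall j\}$, $\boldsymbol i^{-j}$ is $\boldsymbol i$ with $i_j$ lowered by one, and the expected cost of stopping in $\boldsymbol i$ is $G(\boldsymbol i)=A+\sum_j b_j\sum_{r\ge i_j}(r-i_j)P(D_j=r)$. A trigger set $\mathcal U\subset\mathcal S$ defines a Markov chain $(\boldsymbol i^k)_{k\ge 0}$ with $\boldsymbol i^0=\boldsymbol Q$: from $\boldsymbol i\notin\mathcal U$ it moves to $\boldsymbol i^{-j}$ with probability $p_j$, from $\boldsymbol i\in\mathcal U$ it moves to $\boldsymbol Q$. A visit to $\boldsymbol i\in\mathcal U$ costs $G(\boldsymbol i)$ and lasts $\tau$; a visit to $\boldsymbol i\notin\mathcal U$ costs nothing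 and lasts $1/\Lambda$ on average. Call $\mathcal U$ admissible if $\boldsymbol Q\notin\mathcal U$ and the expected number of steps from $\boldsymbol Q$ to $\mathcal U$ is finite. The long-run expected average cost per unit time of $\mathcal U$ is $$\alpha_{\mathcal U}=\limsup_{m\to\infty}\frac{\sum_{k<m}E[\text{cost of the visit to }\boldsymbol i^k]}{\sum_{k<m}E[\text{duration of the visit to }\boldsymbol i^k]},$$ and $\alpha^*$ is the infimum of $\alpha_{\mathcal U}$ over admissible $\mathcal U$; an admissible $\mathcal U$ is optimal if it minimizes $\alpha_{\mathcal U}$ among the admissible sets. With $F(\boldsymbol i)=-G(\boldsymbol i)+\alpha^*\tau$ and $f(\boldsymbol i)=-\alpha^*/\Lambda$, the entrance fee is $f'(\boldsymbol i)=f(\boldsymbol i)-\bigl[\sum_j p_jF(\boldsymbol i^{-j})-F(\boldsymbol i)\bigr]$. Assume $\sum_j b_jQ_jP(D_j\ge Q_j+1)\le A<\sum_j b_jQ_j$. Then the trigger set control policy with stopping set $\mathcal U^*=\{\boldsymbol i\in\mathcal S: f'(\boldsymbol i)>0\}$ and continue set $\overline{\mathcal U}^*=\{\boldsymbol i\in\mathcal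 S: f'(\boldsymbol i)\le 0\}$ is optimal, and for it the limit defining the average cost exists and equals $\alpha^*$. Moreover, if $\mathcal U$ is any optimal trigger set and $\boldsymbol i$ is a state that its chain visits with positive probability, then $\boldsymbol i\notin\mathcal U$ whenever $f'(\boldsymbol i)<0$ and $\boldsymbol i\in\mathcal U$ whenever $f'(\boldsymbol i)>0$. -/

import Mathlib

open Filter Topology ProbabilityTheory
open scoped ENNReal

noncomputable section

/-- Data of the replenishment problem with `J` items: order-up-to levels `Q j`, Poisson demand
rates `rate j`, unit stockout costs `b j`, fixed replenishment cost `A`, lead time `τ`. -/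
structure VendingModel (J : ℕ) where
  Q : Fin J → ℤ
  rate : Fin J → ℝ
  b : Fin J → ℝ
  A : ℝ
  τ : ℝ
  Q_pos : ∀ j, 0 < Q j
  rate_pos : ∀ j, 0 < rate j
  b_nonneg : ∀ j, 0 ≤ b j
  τ_nonneg : 0 ≤ τ

namespace VendingModel

variable {J : ℕ} (M : VendingModel J)

/-- The state space: integer inventory vectors (negative entries record stockouts) that do not
exceed the order-up-to levels. -/
def State : Type := {i : Fin J → ℤ // ∀ j, i j ≤ M.Q j}

/-- The full machine, the initial state of every replenishment cycle. -/
def full : M.State := ⟨M.Q, fun _ => le_rfl⟩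

/-- The state after one demand for item `j`. -/
def dec (i : M.State) (j : Fin J) : M.State :=
  ⟨Function.update i.1 j (i.1 j - 1), fun k => by
    by_cases h : k = j
    · subst h
      have := i.2 k
      simp only [Function.update_self]
      omega
    · simpa [Function.update_of_ne h] using i.2 k⟩

/-- Total demand rate. -/
def totalRate : ℝ := ∑ j, M.rate j

/-- Probability that a demand is for item `j`. -/
def p (j : Fin J) : ℝ := M.rate j / M.totalRate

/-- The law of the demand for item `j` during the lead time. -/
def leadDemand (j : Fin J) : MeasureTheory.Measure ℕ :=
  poissonMeasure (M.rate j * M.τ).toNNReal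

/-- Expected cost of stopping in state `i`: the fixed cost and the stockout costs of the cycle,
those already incurred and those expected during the lead time. -/
def stopCost (i : M.State) : ℝ :=
  M.A + ∑ j, M.b j * ∑' r : ℕ, max ((r : ℝ) - (i.1 j : ℝ)) 0 * (M.leadDemand j).real {r}

theorem sum_ofReal_p [NeZero J] : ∑ j, ENNReal.ofReal (M.p j) = 1 := by
  have hpos : 0 < M.totalRate :=
    Finset.sum_pos (fun j _ => M.rate_pos j) Finset.univ_nonempty
  simp only [p]
  rw [← ENNReal.ofReal_sum_of_nonneg (fun j _ => (div_pos (M.rate_pos j) hpos).le)]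
  rw [← Finset.sum_div]
  change ENNReal.ofReal (M.totalRate / M.totalRate) = 1
  rw [div_self hpos.ne', ENNReal.ofReal_one]

/-- The law of the item asked for by a demand. -/
def demand [NeZero J] : PMF (Fin J) :=
  PMF.ofFintype (fun j => ENNReal.ofReal (M.p j)) M.sum_ofReal_p

/-- Transition kernel of the uniformized chain under the trigger set `U`: a trigger state is
followed by the full state, any other state by the state after the next demand. -/
def step [NeZero J] (U : Set M.State) (i : M.State) : PMF M.State :=
  open Classical in if i ∈ U then PMF.pure M.full else M.demand.map (M.dec i)

/-- Law of the state after `k` transitions of the chain under `U`, started from the full state. -/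
def law [NeZero J] (U : Set M.State) : ℕ → PMF M.State
  | 0 => PMF.pure M.full
  | k + 1 => (law U k).bind (M.step U)

/-- Law after `k` demands of the chain that starts from the full state and is frozen when it
enters `U`. -/
def stopped [NeZero J] (U : Set M.State) : ℕ → PMF M.State
  | 0 => PMF.pure M.full
  | k + 1 => (stopped U k).bind fun i =>
      open Classical in if i ∈ U then PMF.pure i else M.demand.map (M.dec i)

/-- Expected number of demands until the trigger set is entered in a cycle,
`∑ k, P (U is not entered within the first k demands)`. -/
def expCycleSteps [NeZero J] (U : Set M.State) : ℝ≥0∞ :=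
  ∑' k : ℕ, ∑' i : M.State, Uᶜ.indicator (M.stopped U k) i

/-- Admissible trigger sets: no trigger when the machine is full, and the chain returns to the
full state in finite expected time (ergodicity). -/
def Admissible [NeZero J] (U : Set M.State) : Prop :=
  M.full ∉ U ∧ M.expCycleSteps U < ∞

/-- Expectation of `v` under `μ`; used for laws with finite support only. -/
def expect (μ : PMF M.State) (v : M.State → ℝ) : ℝ := ∑' i, (μ i).toReal * v i

/-- Cost incurred at a visit to state `i` under `U`. -/
def visitCost (U : Set M.State) (i : M.State) : ℝ :=
  open Classical in if i ∈ U then M.stopCost i else 0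

/-- Mean time spent at a visit to state `i` under `U`. -/
def visitTime (U : Set M.State) (i : M.State) : ℝ :=
  open Classical in if i ∈ U then M.τ else 1 / M.totalRate

/-- Expected cost per expected unit of time over the first `m` visited states. -/
def avgCostUpTo [NeZero J] (U : Set M.State) (m : ℕ) : ℝ :=
  (∑ k ∈ Finset.range m, M.expect (M.law U k) (M.visitCost U)) /
    (∑ k ∈ Finset.range m, M.expect (M.law U k) (M.visitTime U))

/-- Long-run expected average cost per unit time under `U`. -/
def avgCost [NeZero J] (U : Set M.State) : ℝ := limsup (M.avgCostUpTo U) atTop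

/-- `U` minimizes the long-run expected average cost among the admissible trigger sets. -/
def IsOptimal [NeZero J] (U : Set M.State) : Prop :=
  M.Admissible U ∧ ∀ V : Set M.State, M.Admissible V → M.avgCost U ≤ M.avgCost V

/-- The optimal long-run expected average cost `α*`. -/
def optCost [NeZero J] : ℝ := sInf (M.avgCost '' {U | M.Admissible U})

/-- Reward for stopping, `F(i) = -G(i) + α* τ`. -/
def stopReward [NeZero J] (i : M.State) : ℝ := -M.stopCost i + M.optCost * M.τ

/-- Cost of continuing one step, `f(i) = -α* / Λ`. -/
def contCost [NeZero J] (_i : M.State) : ℝ := -M.optCost * (1 / M.totalRate)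

/-- The entrance fee `f'(i) = f(i) - (∑ j, p_j F(i - e_j) - F(i))`. -/
def entranceFee [NeZero J] (i : M.State) : ℝ :=
  M.contCost i - (∑ j, M.p j * M.stopReward (M.dec i j) - M.stopReward i)

/-- The fixed cost from which on it is optimal not to trigger in the full state. -/
def minFixedCost : ℝ :=
  ∑ j, M.b j * (M.Q j : ℝ) * (M.leadDemand j).real {r : ℕ | M.Q j + 1 ≤ (r : ℤ)}

end VendingModel

end

/-! For a fixed price `α` of time, Dynkin's formula turns `cost - α * duration` of a replenishment
cycle into a constant plus the expected sum of `stockoutRate - α` over the states passed before the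
replenishment. The stockout rate can only grow along a path, so the sign of this summand changes at
most once, and stopping as soon as it is positive minimizes the sum in each step separately, for
all trigger sets at once. By the renewal reward theorem the average cost of a trigger set is the
ratio of its cycle cost and its cycle time, which for `α = α*` makes the look-ahead rule optimal
and any optimal rule equal to it in every step, once the rule is known to attain the infimum `α*`.
It does because the cost of a cycle falls short of `maxRate * duration` by at most the value of the
initial stock; as `α* < maxRate`, ratios close to `α*` cannot be due to arbitrarily long cycles. -/

noncomputable section

section LossFunction

open MeasureTheory

/-- The loss function of inventory theory: the expected excess over the stock `x` of a demand with
law `μ`. -/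
def lossFunction (μ : Measure ℕ) (x : ℤ) : ℝ := ∫ r : ℕ, max ((r : ℝ) - x) 0 ∂μ

/-- The expected part of the stock `x` that a demand with law `μ` leaves over. -/
def expectedSurplus (μ : Measure ℕ) (x : ℤ) : ℝ := ∫ r : ℕ, max ((x : ℝ) - r) 0 ∂μ

/-- The probability that a demand with law `μ` is at least `x`. -/
def tailProb (μ : Measure ℕ) (x : ℤ) : ℝ := μ.real {r : ℕ | x ≤ r}

variable {μ : Measure ℕ} {x : ℤ}

theorem lossFunction_nonneg : 0 ≤ lossFunction μ x :=
  integral_nonneg fun _ => le_max_right _ _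

theorem expectedSurplus_nonneg : 0 ≤ expectedSurplus μ x :=
  integral_nonneg fun _ => le_max_right _ _

theorem expectedSurplus_of_nonpos (hx : x ≤ 0) : expectedSurplus μ x = 0 := by
  have h (r : ℕ) : max ((x : ℝ) - r) 0 = 0 :=
    max_eq_right (sub_nonpos.2 ((Int.cast_nonpos.2 hx).trans r.cast_nonneg))
  simp [expectedSurplus, h]

theorem tailProb_nonneg : 0 ≤ tailProb μ x := measureReal_nonneg

theorem tailProb_antitone [IsFiniteMeasure μ] : Antitone (tailProb μ) := fun _ _ h =>
  measureReal_mono fun _ hr => h.trans hr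

theorem integrable_natCast_sub_intCast [IsFiniteMeasure μ]
    (hμ : Integrable (fun r : ℕ => (r : ℝ)) μ) (x : ℤ) :
    Integrable (fun r : ℕ => (r : ℝ) - x) μ :=
  hμ.sub (integrable_const _)

theorem integrable_indicator_natCast [IsFiniteMeasure μ] (s : Set ℕ) :
    Integrable (s.indicator (1 : ℕ → ℝ)) μ :=
  (integrable_const (1 : ℝ)).indicator .of_discrete

theorem lossFunction_sub_one [IsFiniteMeasure μ]
    (hμ : Integrable (fun r : ℕ => (r : ℝ)) μ) (x : ℤ) :
    lossFunction μ (x - 1) = lossFunction μ x + tailProb μ x := by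
  have hpointwise (r : ℕ) : max ((r : ℝ) - (x - 1 : ℤ)) 0 =
      max ((r : ℝ) - x) 0 + {r : ℕ | x ≤ r}.indicator 1 r := by
    by_cases hr : x ≤ r
    · have : (x : ℝ) ≤ r := mod_cast hr
      rw [Set.indicator_of_mem (by exact hr), max_eq_left (by push_cast; linarith),
        max_eq_left (by linarith), Pi.one_apply]
      push_cast
      ring
    · have : (r : ℝ) ≤ x - 1 := mod_cast Int.le_sub_one_of_lt (not_le.1 hr)
      rw [Set.indicator_of_notMem (by exact hr), max_eq_right (by push_cast; linarith),
        max_eq_right (by linarith), add_zero]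
  simp only [lossFunction, tailProb, hpointwise]
  rw [integral_add (integrable_natCast_sub_intCast hμ x).pos_part
    (integrable_indicator_natCast _), integral_indicator_one .of_discrete]

variable [IsProbabilityMeasure μ]

theorem tailProb_of_nonpos (hx : x ≤ 0) : tailProb μ x = 1 := by
  have huniv : {r : ℕ | x ≤ r} = Set.univ :=
    Set.eq_univ_of_forall fun r => hx.trans (Int.natCast_nonneg r)
  rw [tailProb, huniv, probReal_univ]

theorem expectedSurplus_le {c : ℤ} (hc : 0 ≤ c) (hxc : x ≤ c) : expectedSurplus μ x ≤ c := by
  have hle (r : ℕ) : max ((x : ℝ) - r) 0 ≤ c :=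
    max_le ((sub_le_self _ r.cast_nonneg).trans (mod_cast hxc)) (mod_cast hc)
  simpa [expectedSurplus] using integral_mono_of_nonneg (μ := μ)
    (.of_forall fun _ => le_max_right _ _) (integrable_const (c : ℝ)) (.of_forall hle)

theorem lossFunction_eq_add_expectedSurplus (hμ : Integrable (fun r : ℕ => (r : ℝ)) μ) (x : ℤ) :
    lossFunction μ x = (∫ r : ℕ, (r : ℝ) ∂μ) - x + expectedSurplus μ x := by
  have hpointwise (r : ℕ) : max ((r : ℝ) - x) 0 = (r - x) + max ((x : ℝ) - r) 0 := by
    rw [← neg_sub (r : ℝ) x, max_comm, max_comm (-_)]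
    linarith [max_zero_sub_max_neg_zero_eq_self ((r : ℝ) - x), max_comm (-((r : ℝ) - x)) 0,
      max_comm ((r : ℝ) - x) 0]
  have hsub := integrable_natCast_sub_intCast hμ x
  have hsurplus : Integrable (fun r : ℕ => max ((x : ℝ) - r) 0) μ :=
    ((integrable_const _).sub hμ).pos_part
  simp only [lossFunction, expectedSurplus, hpointwise]
  rw [integral_add hsub hsurplus, integral_sub hμ (integrable_const _)]
  simp

theorem expectedSurplus_sub_one (hμ : Integrable (fun r : ℕ => (r : ℝ)) μ) (x : ℤ) :
    expectedSurplus μ (x - 1) = expectedSurplus μ x + (tailProb μ x - 1) := by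
  have h := lossFunction_sub_one hμ x
  rw [lossFunction_eq_add_expectedSurplus hμ, lossFunction_eq_add_expectedSurplus hμ] at h
  push_cast at h
  linarith

end LossFunction

section Poisson

open MeasureTheory
open scoped NNReal

variable (m : ℝ≥0)

theorem poissonMeasure_real_succ (r : ℕ) :
    (poissonMeasure m).real {r + 1} * (r + 1 : ℕ) = m * (poissonMeasure m).real {r} := by
  simp only [poissonMeasure_real_singleton, Nat.factorial_succ, Nat.cast_mul]
  field_simp
  ring

/-- The Stein–Chen identity. -/
theorem integral_natCast_mul_poissonMeasure (f : ℕ → ℝ) :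
    ∫ r : ℕ, r * f r ∂poissonMeasure m = m * ∫ r, f (r + 1) ∂poissonMeasure m := by
  simp only [integral_poissonMeasure, ← poissonMeasure_real_singleton, smul_eq_mul]
  rw [← tsum_mul_left, ← (add_left_injective 1).tsum_eq]
  · exact tsum_congr fun r => by rw [← mul_assoc, poissonMeasure_real_succ, mul_assoc]
  · intro r hr
    exact ⟨r - 1, Nat.sub_add_cancel (Nat.one_le_iff_ne_zero.2 fun h => by simp [h] at hr)⟩

theorem integrable_natCast_poissonMeasure :
    Integrable (fun r : ℕ => (r : ℝ)) (poissonMeasure m) := by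
  have h := (hasSum_one_poissonMeasure m).summable.mul_left (m : ℝ)
  simp only [integrable_poissonMeasure_iff, ← poissonMeasure_real_singleton,
    Real.norm_natCast] at h ⊢
  rw [← summable_nat_add_iff 1]
  exact h.congr fun r => (poissonMeasure_real_succ m r).symm

theorem integral_natCast_poissonMeasure : ∫ r : ℕ, (r : ℝ) ∂poissonMeasure m = m := by
  simpa using integral_natCast_mul_poissonMeasure m 1

theorem lossFunction_poissonMeasure (x : ℤ) :
    lossFunction (poissonMeasure m) x =
      m * tailProb (poissonMeasure m) x - x * tailProb (poissonMeasure m) (x + 1) := by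
  set e : ℕ → ℝ := {r : ℕ | x + 1 ≤ r}.indicator 1 with he
  have hpointwise (r : ℕ) : max ((r : ℝ) - x) 0 = r * e r - x * e r := by
    by_cases hr : x + 1 ≤ r
    · have : (x : ℝ) + 1 ≤ r := mod_cast hr
      rw [he, Set.indicator_of_mem (by exact hr), max_eq_left (by linarith)]
      simp
    · have : (r : ℝ) ≤ x := mod_cast Int.lt_add_one_iff.1 (not_le.1 hr)
      rw [he, Set.indicator_of_notMem (by exact hr), max_eq_right (by linarith)]
      simp
  have hshift : (fun r : ℕ => e (r + 1)) = {r : ℕ | x ≤ r}.indicator 1 := by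
    ext r
    simp [he, Set.indicator_apply]
  have hint : Integrable (fun r : ℕ => r * e r) (poissonMeasure m) := by
    simpa only [he, ← Set.indicator_mul_right, Pi.one_apply, mul_one] using
      (integrable_natCast_poissonMeasure m).indicator .of_discrete
  simp only [lossFunction, hpointwise]
  rw [integral_sub hint ((integrable_indicator_natCast _).const_mul _), integral_const_mul,
    integral_natCast_mul_poissonMeasure, hshift, integral_indicator_one .of_discrete,
    integral_indicator_one .of_discrete, tailProb, tailProb]

end Poisson

section Asymptotics

open Finset

/-- Olivier's theorem. -/
theorem tendsto_natCast_mul_of_antitone_of_summable {a : ℕ → ℝ} (ha : Antitone a)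
    (hs : Summable a) : Tendsto (fun n : ℕ => (n : ℝ) * a n) atTop (𝓝 0) := by
  have hpos (n : ℕ) : 0 ≤ a n := ha.le_of_tendsto hs.tendsto_atTop_zero n
  have hpartial := hs.hasSum.tendsto_sum_nat
  have hhalf : Tendsto (fun n : ℕ => n / 2) atTop atTop :=
    Nat.tendsto_div_const_atTop two_ne_zero
  have hblock : Tendsto (fun n : ℕ => 2 * (∑ k ∈ range n, a k - ∑ k ∈ range (n / 2), a k))
      atTop (𝓝 0) := by
    simpa using (hpartial.sub (hpartial.comp hhalf)).const_mul 2
  refine squeeze_zero (fun n => mul_nonneg n.cast_nonneg (hpos n)) (fun n => ?_) hblock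
  rw [← sum_Ico_eq_sub _ (n.div_le_self 2)]
  have hterms : ((n - n / 2 : ℕ) : ℝ) * a n ≤ ∑ k ∈ Ico (n / 2) n, a k := by
    rw [← nsmul_eq_mul, ← Nat.card_Ico]
    exact card_nsmul_le_sum _ _ _ fun k hk => ha (mem_Ico.1 hk).2.le
  have hlength : (n : ℝ) ≤ 2 * ((n - n / 2 : ℕ) : ℝ) := mod_cast (by lia : n ≤ 2 * (n - n / 2))
  nlinarith [hpos n]

theorem tendsto_weightedMean_of_isBigO {u x : ℕ → ℝ} {C l : ℝ} (hC : ∀ n, |u n| ≤ C)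
    (hu : (fun m : ℕ => (m : ℝ)) =O[atTop] fun m => ∑ n ∈ range m, u n)
    (hx : Tendsto x atTop (𝓝 l)) :
    Tendsto (fun m => (∑ n ∈ range m, u n * x (m - n)) / ∑ n ∈ range m, u n) atTop (𝓝 l) := by
  have hdev : Tendsto (fun n => |x (n + 1) - l|) atTop (𝓝 0) := by
    simpa using ((hx.comp (tendsto_add_atTop_nat 1)).sub_const l).abs
  have hbound (m : ℕ) : ‖∑ n ∈ range m, u n * (x (m - n) - l)‖ ≤
      C * ‖∑ n ∈ range m, |x (n + 1) - l|‖ := by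
    rw [Real.norm_of_nonneg (sum_nonneg fun _ _ => abs_nonneg _),
      ← sum_range_reflect (fun n => |x (n + 1) - l|), mul_sum]
    refine norm_sum_le_of_le _ fun n hn => ?_
    rw [norm_mul, Real.norm_eq_abs, Real.norm_eq_abs,
      show m - 1 - n + 1 = m - n by grind]
    exact mul_le_mul_of_nonneg_right (hC n) (abs_nonneg _)
  have hlittle : (fun m => ∑ n ∈ range m, u n * (x (m - n) - l)) =o[atTop]
      fun m => ∑ n ∈ range m, u n :=
    ((Asymptotics.IsBigO.of_bound C (.of_forall hbound)).trans_isLittleO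
      (Asymptotics.isLittleO_sum_range_of_tendsto_zero hdev)).trans_isBigO hu
  have hlim := hlittle.tendsto_div_nhds_zero.add_const l
  rw [zero_add] at hlim
  refine hlim.congr' ?_
  filter_upwards [hu.eq_zero_imp, eventually_gt_atTop 0] with m hzero hm
  have hne : ∑ n ∈ range m, u n ≠ 0 := fun h => hm.ne' (Nat.cast_eq_zero.1 (hzero h))
  simp only [mul_sub, sum_sub_distrib, ← sum_mul]
  field_simp
  ring

theorem exists_lt_forall_le_div {ι : Type*} {c t : ι → ℝ} {α β s e : ℝ} (ht : ∀ i, 0 < t i)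
    (hαβ : α < β) (hs : 0 ≤ s) (he : 0 < e) (hβ : ∀ i, -s ≤ c i - β * t i)
    (hα : ∀ i, e ≤ c i - α * t i) : ∃ γ > α, ∀ i, γ ≤ c i / t i := by
  refine ⟨(e * β + s * α) / (e + s), ?_, fun i => ?_⟩
  · rw [gt_iff_lt, lt_div_iff₀ (by positivity)]
    nlinarith
  · rw [div_le_div_iff₀ (by positivity) (ht i)]
    nlinarith [mul_le_mul_of_nonneg_left (hβ i) he.le, mul_le_mul_of_nonneg_left (hα i) hs]

end Asymptotics

section KilledChain

variable {S : Type*}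

/-- `P v i` is the expected value of `v` one transition after the state `i` of a Markov chain. -/
structure IsMarkovOperator (P : Module.End ℝ (S → ℝ)) : Prop where
  monotone : Monotone P
  map_one : P 1 = 1

/-- The transition operator of the chain that is killed in its first transition from a state
of `U`. -/
def killed (P : Module.End ℝ (S → ℝ)) (U : Set S) : Module.End ℝ (S → ℝ) where
  toFun v := Uᶜ.indicator (P v)
  map_add' v w := by rw [map_add, Set.indicator_add']
  map_smul' c v := by rw [map_smul]; exact Set.indicator_const_smul Uᶜ c (P v)

/-- The expected value of `v` after `l` transitions of the killed chain that starts in `o`, with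
value zero once the chain is killed. -/
def killedMean (P : Module.End ℝ (S → ℝ)) (U : Set S) (o : S) (l : ℕ) : (S → ℝ) →ₗ[ℝ] ℝ :=
  LinearMap.proj o ∘ₗ killed P U ^ l

/-- The expected sum of `v` over the states before the entrance into `U`. -/
def occupation (P : Module.End ℝ (S → ℝ)) (U : Set S) (o : S) (v : S → ℝ) : ℝ :=
  ∑' l, killedMean P U o l (Uᶜ.indicator v)

variable {P : Module.End ℝ (S → ℝ)} {U V : Set S} {o : S} {v w : S → ℝ}

theorem killedMean_zero (v : S → ℝ) : killedMean P U o 0 v = v o := by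
  simp [killedMean]

theorem killedMean_succ (l : ℕ) (v : S → ℝ) :
    killedMean P U o (l + 1) v = killedMean P U o l (Uᶜ.indicator (P v)) := by
  simp [killedMean, pow_succ, killed]

theorem killedMean_indicator_add (l : ℕ) (v : S → ℝ) :
    killedMean P U o l (U.indicator v) + killedMean P U o l (Uᶜ.indicator v) =
      killedMean P U o l v := by
  rw [← map_add, Set.indicator_self_add_compl]

theorem occupation_smul (c : ℝ) (v : S → ℝ) :
    occupation P U o (c • v) = c * occupation P U o v := by
  have hindicator : Uᶜ.indicator (c • v) = c • Uᶜ.indicator v :=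
    Set.indicator_const_smul Uᶜ c v
  simp only [occupation, hindicator, map_smul, smul_eq_mul, tsum_mul_left]

/-- Dynkin's formula. -/
theorem sum_killedMean_indicator (m : ℕ) (v : S → ℝ) :
    ∑ l ∈ Finset.range m, killedMean P U o l (U.indicator v) =
      v o - killedMean P U o m v +
        ∑ l ∈ Finset.range m, killedMean P U o l (Uᶜ.indicator (P v - v)) := by
  induction m with
  | zero => simp [killedMean_zero]
  | succ m ih =>
    rw [Finset.sum_range_succ, Finset.sum_range_succ, ih, killedMean_succ, Set.indicator_sub',
      map_sub]
    linarith [killedMean_indicator_add (P := P) (U := U) (o := o) m v]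

namespace IsMarkovOperator

theorem nonneg (hP : IsMarkovOperator P) (hv : 0 ≤ v) : 0 ≤ P v := by
  simpa using hP.monotone hv

theorem killed_pow_nonneg (hP : IsMarkovOperator P) (hv : 0 ≤ v) (l : ℕ) :
    0 ≤ (killed P U ^ l) v := by
  induction l with
  | zero => simpa using hv
  | succ l ih =>
    rw [pow_succ', Module.End.mul_apply]
    exact Set.indicator_nonneg fun i _ => hP.nonneg ih i

theorem killed_pow_anti (hP : IsMarkovOperator P) (hVU : V ⊆ U) (hv : 0 ≤ v) (l : ℕ) :
    (killed P U ^ l) v ≤ (killed P V ^ l) v := by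
  induction l with
  | zero => simp
  | succ l ih =>
    rw [pow_succ', pow_succ', Module.End.mul_apply, Module.End.mul_apply]
    calc Uᶜ.indicator (P ((killed P U ^ l) v))
        ≤ Vᶜ.indicator (P ((killed P U ^ l) v)) :=
          Set.indicator_le_indicator_of_subset (Set.compl_subset_compl.2 hVU)
            (hP.nonneg (hP.killed_pow_nonneg hv l))
      _ ≤ Vᶜ.indicator (P ((killed P V ^ l) v)) :=
          fun i => Set.indicator_le_indicator (hP.monotone ih i)

theorem killedMean_nonneg (hP : IsMarkovOperator P) (hv : 0 ≤ v) (l : ℕ) :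
    0 ≤ killedMean P U o l v :=
  hP.killed_pow_nonneg hv l o

theorem killedMean_mono (hP : IsMarkovOperator P) (l : ℕ) : Monotone (killedMean P U o l) :=
  fun v w h => by
    rw [← sub_nonneg, ← map_sub]
    exact hP.killedMean_nonneg (sub_nonneg.2 h) l

theorem killedMean_anti (hP : IsMarkovOperator P) (hVU : V ⊆ U) (hv : 0 ≤ v) (l : ℕ) :
    killedMean P U o l v ≤ killedMean P V o l v :=
  hP.killed_pow_anti hVU hv l o

theorem abs_killedMean_le (hP : IsMarkovOperator P) (h : |v| ≤ w) (l : ℕ) :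
    |killedMean P U o l v| ≤ killedMean P U o l w :=
  abs_le'.2 ⟨hP.killedMean_mono l (abs_le'.1 h).1, by
    simpa only [map_neg] using hP.killedMean_mono (U := U) (o := o) l (abs_le'.1 h).2⟩

theorem killedMean_succ_one (hP : IsMarkovOperator P) (l : ℕ) :
    killedMean P U o (l + 1) 1 = killedMean P U o l (Uᶜ.indicator 1) := by
  rw [killedMean_succ, hP.map_one]

theorem killedMean_one_antitone (hP : IsMarkovOperator P) :
    Antitone fun l => killedMean P U o l 1 :=
  antitone_nat_of_succ_le fun l => by
    rw [hP.killedMean_succ_one]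
    exact hP.killedMean_mono l (Set.indicator_le_self' fun _ _ => zero_le_one)

theorem killedMean_pos (hP : IsMarkovOperator P) {i : S} {l : ℕ}
    (hi : 0 < killedMean P U o l (({i} : Set S).indicator 1)) (hv : 0 ≤ v) (hvi : 0 < v i) :
    0 < killedMean P U o l v := by
  refine (mul_pos hvi hi).trans_le ?_
  rw [← smul_eq_mul, ← map_smul]
  refine hP.killedMean_mono l fun k => ?_
  rcases eq_or_ne k i with rfl | hk
  · simp
  · simpa [hk] using hv k

theorem summable_killedMean_one_iff (hP : IsMarkovOperator P) :
    (Summable fun l => killedMean P U o l 1) ↔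
      Summable fun l => killedMean P U o l (Uᶜ.indicator 1) := by
  rw [← summable_nat_add_iff 1]
  simp only [hP.killedMean_succ_one]

/-- The criterion of Foster and Lyapunov. -/
theorem summable_killedMean_one (hP : IsMarkovOperator P) (hw : 0 ≤ w)
    (hdrift : ∀ i ∉ U, P w i + 1 ≤ w i) : Summable fun l => killedMean P U o l 1 := by
  refine hP.summable_killedMean_one_iff.2 <| summable_of_sum_range_le (c := w o)
    (fun l => hP.killedMean_nonneg (Set.indicator_nonneg fun _ _ => zero_le_one) l) fun m => ?_
  have hstep (l : ℕ) : killedMean P U o l (Uᶜ.indicator 1) ≤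
      -killedMean P U o l (Uᶜ.indicator (P w - w)) := by
    rw [← map_neg, ← Set.indicator_neg']
    refine hP.killedMean_mono l fun i => Set.indicator_le_indicator' fun hi => ?_
    simpa using le_sub_iff_add_le'.2 (hdrift i hi)
  have hexit : 0 ≤ ∑ l ∈ Finset.range m, killedMean P U o l (U.indicator w) :=
    Finset.sum_nonneg fun l _ => hP.killedMean_nonneg (Set.indicator_nonneg fun i _ => hw i) l
  have hsum := Finset.sum_le_sum fun l (_ : l ∈ Finset.range m) => hstep l
  rw [Finset.sum_neg_distrib] at hsum
  linarith [sum_killedMean_indicator (P := P) (U := U) (o := o) m w,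
    hP.killedMean_nonneg (U := U) (o := o) hw m]

theorem summable_killedMean_indicator (hP : IsMarkovOperator P)
    (hU : Summable fun l => killedMean P U o l 1) {c : ℝ} (h : ∀ i, |v i| ≤ c) :
    Summable fun l => killedMean P U o l (Uᶜ.indicator v) := by
  refine .of_norm_bounded (hU.mul_left c) fun l => ?_
  rw [← smul_eq_mul, ← map_smul]
  refine hP.abs_killedMean_le (fun i => ?_) l
  by_cases hi : i ∈ U
  · simpa [hi] using (abs_nonneg _).trans (h i)
  · simpa [hi] using h i

theorem occupation_add (hP : IsMarkovOperator P) (hU : Summable fun l => killedMean P U o l 1)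
    {c c' : ℝ} (hv : ∀ i, |v i| ≤ c) (hw : ∀ i, |w i| ≤ c') :
    occupation P U o (v + w) = occupation P U o v + occupation P U o w := by
  simp only [occupation, Set.indicator_add', map_add]
  exact (hP.summable_killedMean_indicator hU hv).tsum_add (hP.summable_killedMean_indicator hU hw)

theorem occupation_nonneg (hP : IsMarkovOperator P) (hv : 0 ≤ v) : 0 ≤ occupation P U o v :=
  tsum_nonneg fun l => hP.killedMean_nonneg (Set.indicator_nonneg fun i _ => hv i) l

end IsMarkovOperator

/-- The function `h` of the states increases by one at every transition. -/
def IsClock (P : Module.End ℝ (S → ℝ)) (h : S → ℝ) : Prop := ∀ v, P (h * v) = (h + 1) * P v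

theorem IsClock.killedMean_mul {h : S → ℝ} (hh : IsClock P h) (l : ℕ) (v : S → ℝ) :
    killedMean P U o l (h * v) = (h o + l) * killedMean P U o l v := by
  induction l generalizing v with
  | zero => simp [killedMean_zero]
  | succ l ih =>
    have hstep : Uᶜ.indicator (P (h * v)) = (h + 1) * Uᶜ.indicator (P v) := by
      rw [hh]
      exact funext fun i => Set.indicator_mul_right Uᶜ (h + 1) (P v)
    rw [killedMean_succ, hstep, add_mul, map_add, ih, one_mul, killedMean_succ]
    push_cast
    ring

variable {h : S → ℝ}

theorem IsMarkovOperator.tendsto_killedMean_zero (hP : IsMarkovOperator P) (hh : IsClock P h)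
    (hU : Summable fun l => killedMean P U o l 1) {c c' : ℝ} (hv : ∀ i, |v i| ≤ c + c' * h i) :
    Tendsto (fun l => killedMean P U o l v) atTop (𝓝 0) := by
  have hbound (l : ℕ) : ‖killedMean P U o l v‖ ≤
      (c + c' * h o) * killedMean P U o l 1 + c' * (l * killedMean P U o l 1) := by
    have habs := hP.abs_killedMean_le (U := U) (o := o) (w := c • 1 + c' • (h * 1))
      (fun i => by simpa using hv i) l
    rw [map_add, map_smul, map_smul, hh.killedMean_mul] at habs
    refine habs.trans_eq ?_
    simp only [smul_eq_mul]
    ring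
  refine squeeze_zero_norm hbound ?_
  simpa using (hU.tendsto_atTop_zero.const_mul (c + c' * h o)).add
    ((tendsto_natCast_mul_of_antitone_of_summable hP.killedMean_one_antitone hU).const_mul c')

theorem IsMarkovOperator.tendsto_sum_killedMean_indicator (hP : IsMarkovOperator P)
    (hh : IsClock P h) (hU : Summable fun l => killedMean P U o l 1) {c c' d : ℝ}
    (hv : ∀ i, |v i| ≤ c + c' * h i) (hd : ∀ i, |(P v - v) i| ≤ d) :
    Tendsto (fun m => ∑ l ∈ Finset.range m, killedMean P U o l (U.indicator v)) atTop
      (𝓝 (v o + occupation P U o (P v - v))) := by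
  simp only [sum_killedMean_indicator]
  simpa only [sub_zero, occupation] using
    ((hP.tendsto_killedMean_zero hh hU hv).const_sub (v o)).add
      (hP.summable_killedMean_indicator hU hd).hasSum.tendsto_sum_nat

/-- A set that the chain cannot leave: a function supported outside of it is still supported
outside of it after averaging over a transition. -/
def IsAbsorbing (P : Module.End ℝ (S → ℝ)) (C : Set S) : Prop :=
  ∀ v : S → ℝ, (∀ i ∈ C, v i = 0) → ∀ i ∈ C, P v i = 0

theorem IsAbsorbing.killed_pow_apply (hU : IsAbsorbing P U) (hv : ∀ i ∈ U, v i = 0) (l : ℕ) :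
    (killed P U ^ l) v = (killed P ∅ ^ l) v := by
  have hvanish (l : ℕ) : ∀ i ∈ U, (killed P U ^ l) v i = 0 := by
    cases l with
    | zero => simpa using hv
    | succ l =>
      intro i hi
      rw [pow_succ', Module.End.mul_apply]
      exact Set.indicator_of_notMem (not_not.2 hi) _
  induction l with
  | zero => rfl
  | succ l ih =>
    have hkill : Uᶜ.indicator (P ((killed P U ^ l) v)) = P ((killed P U ^ l) v) :=
      Set.indicator_eq_self.2 fun i hi hiU => hi (hU _ (hvanish l) i hiU)
    rw [pow_succ', pow_succ', Module.End.mul_apply, Module.End.mul_apply, ← ih]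
    simpa [killed] using hkill

theorem IsAbsorbing.killedMean_eq (hU : IsAbsorbing P U) (hv : ∀ i ∈ U, v i = 0) (l : ℕ) :
    killedMean P U o l v = killedMean P ∅ o l v :=
  congrFun (hU.killed_pow_apply hv l) o

/-- The loss of `U` against the one-step look-ahead rule `{0 < g}`, in step `l`: entering too late
where `g` is positive, and too early where it is negative, now or before step `l`. -/
theorem killedMean_sub_killedMean_pos (hC : IsAbsorbing P {i | 0 < v i}) (l : ℕ) :
    killedMean P U o l (Uᶜ.indicator v) -
        killedMean P {i | 0 < v i} o l ({i | 0 < v i}ᶜ.indicator v) =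
      killedMean P U o l (Uᶜ.indicator v⁺) + killedMean P U o l (U.indicator v⁻) +
        (killedMean P ∅ o l v⁻ - killedMean P U o l v⁻) := by
  have hneg : {i | 0 < v i}ᶜ.indicator v = -v⁻ := by
    ext i
    by_cases hi : 0 < v i
    · simp [hi, hi.le]
    · simp [hi, not_lt.1 hi]
  have hsplit : Uᶜ.indicator v = Uᶜ.indicator v⁺ - Uᶜ.indicator v⁻ := by
    rw [← Set.indicator_sub', posPart_sub_negPart]
  rw [hneg, map_neg, hC.killedMean_eq fun i hi => by simpa using le_of_lt hi, hsplit, map_sub,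
    ← killedMean_indicator_add (U := U) l v⁻]
  ring

theorem IsMarkovOperator.killedMean_pos_le (hP : IsMarkovOperator P)
    (hC : IsAbsorbing P {i | 0 < v i}) (l : ℕ) :
    killedMean P {i | 0 < v i} o l ({i | 0 < v i}ᶜ.indicator v) ≤
      killedMean P U o l (Uᶜ.indicator v) := by
  have hlate : 0 ≤ killedMean P U o l (Uᶜ.indicator v⁺) :=
    hP.killedMean_nonneg (Set.indicator_nonneg fun i _ => posPart_nonneg v i) l
  have hearly : 0 ≤ killedMean P U o l (U.indicator v⁻) :=
    hP.killedMean_nonneg (Set.indicator_nonneg fun i _ => negPart_nonneg v i) l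
  have hmissed := hP.killedMean_anti (o := o) (Set.empty_subset U) (negPart_nonneg v) l
  linarith [killedMean_sub_killedMean_pos (U := U) (o := o) hC l]

theorem IsMarkovOperator.sign_of_killedMean_eq (hP : IsMarkovOperator P)
    (hC : IsAbsorbing P {i | 0 < v i}) {l : ℕ}
    (heq : killedMean P {i | 0 < v i} o l ({i | 0 < v i}ᶜ.indicator v) =
      killedMean P U o l (Uᶜ.indicator v)) {i : S}
    (hi : 0 < killedMean P U o l (({i} : Set S).indicator 1)) :
    (v i < 0 → i ∉ U) ∧ (0 < v i → i ∈ U) := by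
  have hlate_nonneg : 0 ≤ Uᶜ.indicator v⁺ := Set.indicator_nonneg fun i _ => posPart_nonneg v i
  have hearly_nonneg : 0 ≤ U.indicator v⁻ := Set.indicator_nonneg fun i _ => negPart_nonneg v i
  have hloss := killedMean_sub_killedMean_pos (U := U) (o := o) hC l
  have hlate := hP.killedMean_nonneg (U := U) (o := o) hlate_nonneg l
  have hearly := hP.killedMean_nonneg (U := U) (o := o) hearly_nonneg l
  have hmissed := hP.killedMean_anti (o := o) (Set.empty_subset U) (negPart_nonneg v) l
  constructor
  · intro hvi hiU
    have := hP.killedMean_pos hi hearly_nonneg (by simpa [hiU] using hvi)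
    linarith
  · intro hvi
    by_contra hiU
    have := hP.killedMean_pos hi hlate_nonneg (by simpa [hiU] using hvi)
    linarith

end KilledChain

section Restart

open Finset

variable {S : Type*}

/-- The transition operator of the chain that moves to `o` from the states of `U` and follows `P`
elsewhere. -/
def restart (P : Module.End ℝ (S → ℝ)) (U : Set S) (o : S) : Module.End ℝ (S → ℝ) :=
  (LinearMap.proj o).smulRight (U.indicator 1) + killed P U

/-- The probability that the chain which restarts in `o` from the states of `U`, and is in `o` at
time zero, begins a cycle at time `k`. -/
def renewalProb (P : Module.End ℝ (S → ℝ)) (U : Set S) (o : S) : ℕ → ℝ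
  | 0 => 1
  | k + 1 => killedMean (restart P U o) ∅ o k (U.indicator 1)

variable {P : Module.End ℝ (S → ℝ)} {U : Set S} {o : S} {v w : S → ℝ}

theorem restart_apply (v : S → ℝ) :
    restart P U o v = v o • U.indicator 1 + Uᶜ.indicator (P v) := rfl

theorem killedMean_empty_succ (l : ℕ) (v : S → ℝ) :
    killedMean P ∅ o (l + 1) v = killedMean P ∅ o l (P v) := by
  simp [killedMean_succ]

theorem killedMean_restart_eq_sum (k : ℕ) (v : S → ℝ) :
    killedMean (restart P U o) ∅ o k v =
      ∑ n ∈ range (k + 1), renewalProb P U o n * killedMean P U o (k - n) v := by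
  induction k generalizing v with
  | zero => simp [killedMean_zero, renewalProb]
  | succ k ih =>
    have hcycle : ∀ n ∈ range (k + 1), renewalProb P U o n * killedMean P U o (k + 1 - n) v =
        renewalProb P U o n * killedMean P U o (k - n) (Uᶜ.indicator (P v)) := fun n hn => by
      rw [Nat.succ_sub (mem_range_succ_iff.1 hn), killedMean_succ]
    rw [killedMean_empty_succ, restart_apply, map_add, map_smul, ih (Uᶜ.indicator (P v)),
      sum_range_succ _ (k + 1), sum_congr rfl hcycle, Nat.sub_self, killedMean_zero, smul_eq_mul,
      renewalProb]
    ring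

theorem sum_killedMean_restart (m : ℕ) (v : S → ℝ) :
    ∑ k ∈ range m, killedMean (restart P U o) ∅ o k v =
      ∑ n ∈ range m, renewalProb P U o n * ∑ l ∈ range (m - n), killedMean P U o l v := by
  simp only [killedMean_restart_eq_sum, mul_sum]
  exact sum_range_diag_flip m fun n l => renewalProb P U o n * killedMean P U o l v

namespace IsMarkovOperator

protected theorem restart (hP : IsMarkovOperator P) : IsMarkovOperator (restart P U o) where
  monotone v w h := by
    rw [restart_apply, restart_apply]
    refine add_le_add (fun i => mul_le_mul_of_nonneg_right (h o) ?_) fun i =>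
      Set.indicator_le_indicator (hP.monotone h i)
    exact Set.indicator_nonneg (fun _ _ => zero_le_one) i
  map_one := by
    rw [restart_apply, hP.map_one, Pi.one_apply, one_smul, Set.indicator_self_add_compl]

theorem killedMean_empty_one (hP : IsMarkovOperator P) (l : ℕ) : killedMean P ∅ o l 1 = 1 := by
  induction l with
  | zero => simp [killedMean_zero]
  | succ l ih => rw [killedMean_empty_succ, hP.map_one, ih]

theorem renewalProb_nonneg (hP : IsMarkovOperator P) (k : ℕ) : 0 ≤ renewalProb P U o k := by
  cases k with
  | zero => exact zero_le_one
  | succ k =>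
    exact hP.restart.killedMean_nonneg (Set.indicator_nonneg fun _ _ => zero_le_one) k

theorem renewalProb_le_one (hP : IsMarkovOperator P) (k : ℕ) : renewalProb P U o k ≤ 1 := by
  cases k with
  | zero => exact le_rfl
  | succ k =>
    rw [← (hP.restart (U := U)).killedMean_empty_one (o := o) k]
    exact hP.restart.killedMean_mono k (Set.indicator_le_self' fun _ _ => zero_le_one)

theorem natCast_isBigO_sum_renewalProb (hP : IsMarkovOperator P)
    (hU : Summable fun l => killedMean P U o l 1) :
    (fun m : ℕ => (m : ℝ)) =O[atTop] fun m => ∑ n ∈ range m, renewalProb P U o n := by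
  refine .of_bound (∑' l, killedMean P U o l 1) (.of_forall fun m => ?_)
  have hcount : (m : ℝ) =
      ∑ n ∈ range m, renewalProb P U o n * ∑ l ∈ range (m - n), killedMean P U o l 1 := by
    simp [← sum_killedMean_restart, hP.restart.killedMean_empty_one]
  rw [Real.norm_natCast, Real.norm_of_nonneg (sum_nonneg fun n _ => hP.renewalProb_nonneg n),
    mul_comm, sum_mul, hcount]
  exact sum_le_sum fun n _ => mul_le_mul_of_nonneg_left
    (hU.sum_le_tsum _ fun l _ => hP.killedMean_nonneg zero_le_one l) (hP.renewalProb_nonneg n)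

/-- The renewal reward theorem. -/
theorem tendsto_sum_restart_div_sum_restart (hP : IsMarkovOperator P)
    (hU : Summable fun l => killedMean P U o l 1) {x y : ℝ}
    (hv : Tendsto (fun m => ∑ l ∈ range m, killedMean P U o l v) atTop (𝓝 x))
    (hw : Tendsto (fun m => ∑ l ∈ range m, killedMean P U o l w) atTop (𝓝 y)) (hy : y ≠ 0) :
    Tendsto (fun m => (∑ k ∈ range m, killedMean (restart P U o) ∅ o k v) /
      ∑ k ∈ range m, killedMean (restart P U o) ∅ o k w) atTop (𝓝 (x / y)) := by
  have hbounded (n : ℕ) : |renewalProb P U o n| ≤ 1 :=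
    (abs_of_nonneg (hP.renewalProb_nonneg n)).trans_le (hP.renewalProb_le_one n)
  have hdensity := hP.natCast_isBigO_sum_renewalProb hU
  refine ((tendsto_weightedMean_of_isBigO hbounded hdensity hv).div
    (tendsto_weightedMean_of_isBigO hbounded hdensity hw) hy).congr' ?_
  filter_upwards [hdensity.eq_zero_imp, eventually_gt_atTop 0] with m hzero hm
  have hne : ∑ n ∈ range m, renewalProb P U o n ≠ 0 := fun h =>
    hm.ne' (Nat.cast_eq_zero.1 (hzero h))
  simp only [sum_killedMean_restart, Pi.div_apply, div_div_div_cancel_right₀ hne]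

end IsMarkovOperator

end Restart

section FiniteSupport

variable {α β : Type*}

/-- The expected value of `v` under `μ`, for laws of finite support. -/
def pmfMean (μ : PMF α) (v : α → ℝ) : ℝ := ∑' a, (μ a).toReal * v a

theorem pmfMean_eq_sum {μ : PMF α} {s : Finset α} (hs : μ.support ⊆ s) (v : α → ℝ) :
    pmfMean μ v = ∑ a ∈ s, (μ a).toReal * v a :=
  tsum_eq_sum fun a ha => by simp [(μ.apply_eq_zero_iff a).2 fun h => ha (hs h)]

theorem pmfMean_pure (a : α) (v : α → ℝ) : pmfMean (PMF.pure a) v = v a := by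
  rw [pmfMean_eq_sum (s := {a}) (by simp)]
  simp

theorem finite_support_bind {μ : PMF α} {f : α → PMF β} (hμ : μ.support.Finite)
    (hf : ∀ a, (f a).support.Finite) : (μ.bind f).support.Finite := by
  rw [PMF.support_bind]
  exact hμ.biUnion fun a _ => hf a

theorem pmfMean_bind {μ : PMF α} {f : α → PMF β} (hμ : μ.support.Finite)
    (hf : ∀ a, (f a).support.Finite) (v : β → ℝ) :
    pmfMean (μ.bind f) v = pmfMean μ fun a => pmfMean (f a) v := by
  lift μ.support to Finset α using hμ with s hs
  have hbind := finite_support_bind (hs ▸ s.finite_toSet) hf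
  lift (μ.bind f).support to Finset β using hbind with t ht
  have hcond {a : α} (ha : a ∈ s) : (f a).support ⊆ t := fun b hb =>
    ht ▸ (PMF.mem_support_bind_iff μ f b).2 ⟨a, hs ▸ ha, hb⟩
  have happly (b : β) : ((μ.bind f) b).toReal = ∑ a ∈ s, (μ a).toReal * (f a b).toReal := by
    rw [PMF.bind_apply, tsum_eq_sum (s := s) fun a ha => by
      simp [(μ.apply_eq_zero_iff a).2 fun h => ha (by simpa [← hs] using h)],
      ENNReal.toReal_sum fun a _ => ENNReal.mul_ne_top (μ.apply_ne_top a) ((f a).apply_ne_top b)]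
    simp only [ENNReal.toReal_mul]
  rw [pmfMean_eq_sum ht.ge, pmfMean_eq_sum hs.ge]
  simp only [happly, Finset.sum_mul]
  rw [Finset.sum_comm]
  refine Finset.sum_congr rfl fun a ha => ?_
  rw [pmfMean_eq_sum (hcond ha), Finset.mul_sum]
  simp only [mul_assoc]

theorem pmfMean_singleton_indicator (μ : PMF α) (a : α) :
    pmfMean μ (({a} : Set α).indicator 1) = (μ a).toReal := by
  rw [pmfMean, tsum_eq_single a fun b hb => by simp [hb]]
  simp

theorem pmfMean_indicator_one (μ : PMF α) (s : Set α) :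
    ENNReal.ofReal (pmfMean μ (s.indicator 1)) = ∑' a, s.indicator μ a := by
  have hle : ∑' a, s.indicator μ a ≤ 1 :=
    (ENNReal.tsum_le_tsum fun a => Set.indicator_le_self s μ a).trans_eq μ.tsum_coe
  have hne := ne_top_of_le_ne_top ENNReal.one_ne_top hle
  have happly (a : α) : (μ a).toReal * s.indicator 1 a = (s.indicator μ a).toReal := by
    by_cases ha : a ∈ s <;> simp [ha]
  rw [pmfMean, tsum_congr happly,
    ← ENNReal.tsum_toReal_eq (ENNReal.ne_top_of_tsum_ne_top hne), ENNReal.ofReal_toReal hne]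

end FiniteSupport

namespace VendingModel

section Chain

variable {J : ℕ} {M : VendingModel J} {U : Set M.State} {v : M.State → ℝ}

variable (M) in
/-- The transition operator of the inventory chain without replenishments, in which every
transition is a demand. -/
def demandOp : Module.End ℝ (M.State → ℝ) :=
  ∑ j, M.p j • LinearMap.funLeft ℝ ℝ fun i => M.dec i j

variable (M) in
/-- Number of demands since the machine was full. -/
def level (i : M.State) : ℝ := ∑ j, ((M.Q j : ℝ) - i.1 j)

theorem demandOp_apply (v : M.State → ℝ) (i : M.State) :
    M.demandOp v i = ∑ j, M.p j * v (M.dec i j) := by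
  simp [demandOp, LinearMap.funLeft]

theorem sum_dec (f : Fin J → ℤ → ℝ) (i : M.State) (j : Fin J) :
    ∑ k, f k ((M.dec i j).1 k) = ∑ k, f k (i.1 k) + (f j (i.1 j - 1) - f j (i.1 j)) := by
  rw [← sub_eq_iff_eq_add', ← Finset.sum_sub_distrib, Finset.sum_eq_single j]
  · simp [dec]
  · intro k _ hk
    simp [dec, Function.update_of_ne hk]
  · simp

theorem level_dec (i : M.State) (j : Fin J) : M.level (M.dec i j) = M.level i + 1 := by
  rw [level, sum_dec fun k x => (M.Q k : ℝ) - x, level]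
  push_cast
  ring

theorem isClock_level : IsClock M.demandOp M.level := fun v => by
  ext i
  simp only [demandOp_apply, Pi.mul_apply, Pi.add_apply, Pi.one_apply, level_dec, Finset.mul_sum]
  exact Finset.sum_congr rfl fun j _ => mul_left_comm _ _ _

variable [NeZero J]

theorem totalRate_pos : 0 < M.totalRate :=
  Finset.sum_pos (fun j _ => M.rate_pos j) Finset.univ_nonempty

theorem p_pos (j : Fin J) : 0 < M.p j := div_pos (M.rate_pos j) totalRate_pos

theorem sum_p : ∑ j, M.p j = 1 := by
  simp only [p, ← Finset.sum_div]
  exact div_self totalRate_pos.ne'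

theorem isMarkovOperator_demandOp : IsMarkovOperator M.demandOp where
  monotone v w h i := by
    simp only [demandOp_apply]
    exact Finset.sum_le_sum fun j _ => mul_le_mul_of_nonneg_left (h _) (p_pos j).le
  map_one := by
    ext i
    simp [demandOp_apply, sum_p]

theorem demandOp_apply_of_dec {i : M.State} {d : Fin J → ℝ}
    (h : ∀ j, v (M.dec i j) = v i + d j) : M.demandOp v i = v i + ∑ j, M.p j * d j := by
  simp only [demandOp_apply, h, mul_add, Finset.sum_add_distrib, ← Finset.sum_mul, sum_p, one_mul]

theorem finite_support_demand_map (i : M.State) : (M.demand.map (M.dec i)).support.Finite := by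
  rw [PMF.support_map]
  exact (Set.toFinite _).image _

theorem pmfMean_demand_map (i : M.State) (v : M.State → ℝ) :
    pmfMean (M.demand.map (M.dec i)) v = M.demandOp v i := by
  rw [← PMF.bind_pure_comp, pmfMean_bind (Set.toFinite _) fun j => by simp, demandOp_apply,
    pmfMean_eq_sum (s := Finset.univ) (by simp)]
  simp [pmfMean_pure, demand, ENNReal.toReal_ofReal (p_pos _).le]

theorem finite_support_step (U : Set M.State) (i : M.State) : (M.step U i).support.Finite := by
  unfold step
  split_ifs
  · simp
  · exact finite_support_demand_map i

theorem pmfMean_step (i : M.State) (v : M.State → ℝ) :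
    pmfMean (M.step U i) v = restart M.demandOp U M.full v i := by
  rw [restart_apply]
  by_cases hi : i ∈ U <;> simp [step, hi, pmfMean_pure, pmfMean_demand_map]

theorem finite_support_law (U : Set M.State) (k : ℕ) : (M.law U k).support.Finite := by
  induction k with
  | zero => simp [law]
  | succ k ih => exact finite_support_bind ih (finite_support_step U)

theorem pmfMean_law (k : ℕ) (v : M.State → ℝ) :
    pmfMean (M.law U k) v = killedMean (restart M.demandOp U M.full) ∅ M.full k v := by
  induction k generalizing v with
  | zero => rw [killedMean_zero, law, pmfMean_pure]
  | succ k ih =>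
    rw [law, pmfMean_bind (finite_support_law U k) (finite_support_step U), killedMean_empty_succ,
      ← ih]
    simp only [pmfMean_step]

theorem finite_support_stopped (U : Set M.State) (k : ℕ) : (M.stopped U k).support.Finite := by
  induction k with
  | zero => simp [stopped]
  | succ k ih =>
    refine finite_support_bind ih fun i => ?_
    split_ifs
    · simp
    · exact finite_support_demand_map i

theorem pmfMean_stopped_indicator (k : ℕ) (v : M.State → ℝ) :
    pmfMean (M.stopped U k) (Uᶜ.indicator v) =
      killedMean M.demandOp U M.full k (Uᶜ.indicator v) := by
  induction k generalizing v with
  | zero => rw [killedMean_zero, stopped, pmfMean_pure]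
  | succ k ih =>
    rw [killedMean_succ, ← ih, stopped, pmfMean_bind (finite_support_stopped U k)]
    · congr 1
      ext i
      by_cases hi : i ∈ U <;> simp [hi, pmfMean_pure, pmfMean_demand_map]
    · intro i
      split_ifs
      · simp
      · exact finite_support_demand_map i

theorem expCycleSteps_eq :
    M.expCycleSteps U =
      ∑' k, ENNReal.ofReal (killedMean M.demandOp U M.full k (Uᶜ.indicator 1)) := by
  simp only [expCycleSteps, ← pmfMean_stopped_indicator, pmfMean_indicator_one]

theorem admissible_iff :
    M.Admissible U ↔ M.full ∉ U ∧ Summable fun k => killedMean M.demandOp U M.full k 1 := by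
  have hnonneg (k : ℕ) : 0 ≤ killedMean M.demandOp U M.full k (Uᶜ.indicator 1) :=
    isMarkovOperator_demandOp.killedMean_nonneg (Set.indicator_nonneg fun _ _ => zero_le_one) k
  rw [Admissible, expCycleSteps_eq, isMarkovOperator_demandOp.summable_killedMean_one_iff,
    lt_top_iff_ne_top]
  refine and_congr_right fun _ => ⟨fun h => ?_, fun h => h.tsum_ofReal_ne_top⟩
  exact (ENNReal.summable_toReal h).congr fun k => ENNReal.toReal_ofReal (hnonneg k)

theorem Admissible.summable (hU : M.Admissible U) :
    Summable fun k => killedMean M.demandOp U M.full k 1 :=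
  (admissible_iff.1 hU).2

theorem exists_killedMean_pos_of_mem_support {i : M.State} {k : ℕ}
    (hi : i ∈ (M.law U k).support) :
    ∃ l, 0 < killedMean M.demandOp U M.full l (({i} : Set M.State).indicator 1) := by
  have hpos : 0 < pmfMean (M.law U k) (({i} : Set M.State).indicator 1) := by
    rw [pmfMean_singleton_indicator]
    exact ENNReal.toReal_pos hi (PMF.apply_ne_top _ _)
  rw [pmfMean_law, killedMean_restart_eq_sum] at hpos
  by_contra! h
  exact hpos.not_ge <| Finset.sum_nonpos fun n _ => mul_nonpos_of_nonneg_of_nonpos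
    (isMarkovOperator_demandOp.renewalProb_nonneg n) (h _)

end Chain

section Costs

variable {J : ℕ} {M : VendingModel J} {i : M.State}

variable (M) in
/-- The set of states in which no item is in stock. -/
def emptyStates : Set M.State := {i | ∀ j, i.1 j ≤ 0}

/-- The rate at which the expected stopping cost grows while the replenishment is delayed. -/
def stockoutRate (i : M.State) : ℝ :=
  ∑ j, M.rate j * (M.b j * tailProb (M.leadDemand j) (i.1 j))

variable (M) in
/-- The stockout rate of the states of `emptyStates`. -/
def maxRate : ℝ := ∑ j, M.rate j * M.b j

/-- The expected value, at the unit stockout costs, of the stock left over when the replenishment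
triggered in the state `i` arrives. -/
def leftover (i : M.State) : ℝ := ∑ j, M.b j * expectedSurplus (M.leadDemand j) (i.1 j)

instance (j : Fin J) : MeasureTheory.IsProbabilityMeasure (M.leadDemand j) :=
  inferInstanceAs (MeasureTheory.IsProbabilityMeasure (poissonMeasure _))

theorem coe_toNNReal_rate_mul_τ (j : Fin J) : ((M.rate j * M.τ).toNNReal : ℝ) = M.rate j * M.τ :=
  Real.coe_toNNReal _ (mul_nonneg (M.rate_pos j).le M.τ_nonneg)

theorem integrable_natCast_leadDemand (j : Fin J) :
    MeasureTheory.Integrable (fun r : ℕ => (r : ℝ)) (M.leadDemand j) :=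
  integrable_natCast_poissonMeasure _

theorem lossFunction_leadDemand (j : Fin J) (x : ℤ) :
    lossFunction (M.leadDemand j) x =
      M.rate j * M.τ - x + expectedSurplus (M.leadDemand j) x := by
  rw [lossFunction_eq_add_expectedSurplus (integrable_natCast_leadDemand j), leadDemand,
    integral_natCast_poissonMeasure, coe_toNNReal_rate_mul_τ]

theorem stopCost_eq (i : M.State) :
    M.stopCost i = M.A + ∑ j, M.b j * lossFunction (M.leadDemand j) (i.1 j) := by
  simp only [stopCost, lossFunction, leadDemand, integral_poissonMeasure,
    poissonMeasure_real_singleton, smul_eq_mul, mul_comm (max _ _)]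

theorem stopCost_eq_add_leftover (i : M.State) :
    M.stopCost i = M.A + ∑ j, M.b j * (M.rate j * M.τ - i.1 j) + leftover i := by
  simp only [stopCost_eq, lossFunction_leadDemand, mul_add, Finset.sum_add_distrib, leftover,
    add_assoc]

theorem stopCost_full :
    M.stopCost M.full = M.A - M.minFixedCost + M.τ * stockoutRate M.full := by
  have hloss (j : Fin J) : M.b j * lossFunction (M.leadDemand j) (M.Q j) =
      M.τ * (M.rate j * (M.b j * tailProb (M.leadDemand j) (M.Q j))) -
        M.b j * M.Q j * tailProb (M.leadDemand j) (M.Q j + 1) := by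
    simp only [leadDemand]
    rw [lossFunction_poissonMeasure, coe_toNNReal_rate_mul_τ]
    ring
  calc M.stopCost M.full
      = M.A + ∑ j, M.b j * lossFunction (M.leadDemand j) (M.Q j) := stopCost_eq _
    _ = M.A + (M.τ * stockoutRate M.full - M.minFixedCost) := by
      simp only [hloss, Finset.sum_sub_distrib, ← Finset.mul_sum]
      rfl
    _ = M.A - M.minFixedCost + M.τ * stockoutRate M.full := by ring

theorem stopCost_dec (i : M.State) (j : Fin J) :
    M.stopCost (M.dec i j) =
      M.stopCost i + M.b j * tailProb (M.leadDemand j) (i.1 j) := by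
  rw [stopCost_eq, stopCost_eq,
    sum_dec fun k x => M.b k * lossFunction (M.leadDemand k) x,
    lossFunction_sub_one (integrable_natCast_leadDemand j)]
  ring

theorem leftover_dec (i : M.State) (j : Fin J) :
    leftover (M.dec i j) =
      leftover i + M.b j * (tailProb (M.leadDemand j) (i.1 j) - 1) := by
  rw [leftover, leftover, sum_dec fun k x => M.b k * expectedSurplus (M.leadDemand k) x,
    expectedSurplus_sub_one (integrable_natCast_leadDemand j)]
  ring

theorem leftover_nonneg : 0 ≤ leftover i :=
  Finset.sum_nonneg fun j _ => mul_nonneg (M.b_nonneg j) expectedSurplus_nonneg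

theorem leftover_le : leftover i ≤ ∑ j, M.b j * (M.Q j : ℝ) :=
  Finset.sum_le_sum fun j _ => mul_le_mul_of_nonneg_left
    (expectedSurplus_le (M.Q_pos j).le (i.2 j)) (M.b_nonneg j)

theorem leftover_eq_zero (hi : i ∈ M.emptyStates) : leftover i = 0 :=
  Finset.sum_eq_zero fun j _ => by rw [expectedSurplus_of_nonpos (hi j), mul_zero]

theorem stockoutRate_nonneg : 0 ≤ stockoutRate i :=
  Finset.sum_nonneg fun j _ =>
    mul_nonneg (M.rate_pos j).le (mul_nonneg (M.b_nonneg j) tailProb_nonneg)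

theorem stockoutRate_antitone {i k : M.State} (h : ∀ j, k.1 j ≤ i.1 j) :
    stockoutRate i ≤ stockoutRate k :=
  Finset.sum_le_sum fun j _ => mul_le_mul_of_nonneg_left
    (mul_le_mul_of_nonneg_left (tailProb_antitone (h j)) (M.b_nonneg j)) (M.rate_pos j).le

theorem stockoutRate_le_dec (i : M.State) (j : Fin J) :
    stockoutRate i ≤ stockoutRate (M.dec i j) :=
  stockoutRate_antitone <| update_le_self_iff.2 (sub_le_self _ zero_le_one)

theorem stockoutRate_eq_maxRate (hi : i ∈ M.emptyStates) : stockoutRate i = M.maxRate :=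
  Finset.sum_congr rfl fun j _ => by rw [tailProb_of_nonpos (hi j), mul_one]

theorem stockoutRate_le_maxRate : stockoutRate i ≤ M.maxRate :=
  Finset.sum_le_sum fun j _ => mul_le_mul_of_nonneg_left
    (mul_le_of_le_one_right (M.b_nonneg j) MeasureTheory.measureReal_le_one) (M.rate_pos j).le

theorem sub_le_level (i : M.State) (j : Fin J) : (M.Q j : ℝ) - i.1 j ≤ M.level i :=
  Finset.single_le_sum (f := fun j => (M.Q j : ℝ) - i.1 j)
    (fun k _ => sub_nonneg.2 (mod_cast i.2 k)) (Finset.mem_univ j)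

theorem abs_stopCost_le (i : M.State) :
    |M.stopCost i| ≤
      (|M.A| + ∑ j, M.b j * (M.rate j * M.τ)) + (∑ j, M.b j) * M.level i := by
  have hloss (j : Fin J) : M.b j * lossFunction (M.leadDemand j) (i.1 j) ≤
      M.b j * (M.rate j * M.τ) + M.b j * M.level i := by
    rw [← mul_add, lossFunction_leadDemand]
    refine mul_le_mul_of_nonneg_left ?_ (M.b_nonneg j)
    linarith [sub_le_level i j, expectedSurplus_le (μ := M.leadDemand j) (M.Q_pos j).le (i.2 j)]
  have hnonneg : 0 ≤ ∑ j, M.b j * lossFunction (M.leadDemand j) (i.1 j) :=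
    Finset.sum_nonneg fun j _ => mul_nonneg (M.b_nonneg j) lossFunction_nonneg
  rw [stopCost_eq, Finset.sum_mul, add_assoc, ← Finset.sum_add_distrib]
  refine (abs_add_le _ _).trans (add_le_add_right ?_ _)
  rw [abs_of_nonneg hnonneg]
  exact Finset.sum_le_sum fun j _ => hloss j

variable [NeZero J]

theorem demandOp_stopCost_sub :
    M.demandOp M.stopCost - M.stopCost = M.totalRate⁻¹ • stockoutRate := by
  ext i
  rw [Pi.sub_apply, demandOp_apply_of_dec (stopCost_dec i), add_sub_cancel_left, Pi.smul_apply,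
    smul_eq_mul, stockoutRate, Finset.mul_sum]
  exact Finset.sum_congr rfl fun j _ => by rw [p]; ring

theorem demandOp_leftover_sub :
    M.demandOp leftover - leftover =
      M.totalRate⁻¹ • (stockoutRate - Function.const M.State M.maxRate) := by
  ext i
  rw [Pi.sub_apply, demandOp_apply_of_dec (leftover_dec i), add_sub_cancel_left, Pi.smul_apply,
    smul_eq_mul, Pi.sub_apply, Function.const_apply, stockoutRate, maxRate,
    ← Finset.sum_sub_distrib, Finset.mul_sum]
  exact Finset.sum_congr rfl fun j _ => by rw [p]; ring

end Costs

section Optimality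

variable {J : ℕ} {M : VendingModel J}

/-- The net rate at which the expected cost grows in the state `i` while the replenishment is
delayed, when every unit of time is worth `α`. -/
def excess (α : ℝ) : M.State → ℝ := stockoutRate - Function.const M.State α

variable (M) in
/-- The trigger set of the one-step look-ahead rule for the average cost `α`: replenish as soon as
the delay until the next demand costs more than `α` per unit of time. -/
def lookAhead (α : ℝ) : Set M.State := {i | 0 < excess α i}

theorem abs_excess_le (α : ℝ) (i : M.State) : |excess α i| ≤ M.maxRate + |α| :=
  (abs_sub _ _).trans <| add_le_add_left
    ((abs_of_nonneg stockoutRate_nonneg).trans_le stockoutRate_le_maxRate) _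

theorem isAbsorbing_lookAhead (α : ℝ) : IsAbsorbing M.demandOp (M.lookAhead α) :=
  fun v hv i hi => by
    have hdec (j : Fin J) : M.dec i j ∈ M.lookAhead α :=
      hi.trans_le (sub_le_sub_right (stockoutRate_le_dec i j) α)
    simp [demandOp_apply, hv _ (hdec _)]

variable [NeZero J] {U : Set M.State}

variable (M) in
/-- The expected cost of a replenishment cycle under the trigger set `U`. -/
def cycleCost (U : Set M.State) : ℝ :=
  M.stopCost M.full + M.totalRate⁻¹ * occupation M.demandOp U M.full stockoutRate

variable (M) in
/-- The expected duration of a replenishment cycle under the trigger set `U`. -/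
def cycleTime (U : Set M.State) : ℝ :=
  M.τ + M.totalRate⁻¹ * occupation M.demandOp U M.full 1

theorem full_notMem_emptyStates : M.full ∉ M.emptyStates := fun h => (M.Q_pos 0).not_ge (h 0)

theorem demandOp_sum_max_div_p_add_one_le {i : M.State} (hi : i ∉ M.emptyStates) :
    M.demandOp (fun k => ∑ j, max (k.1 j : ℝ) 0 / M.p j) i + 1 ≤
      ∑ j, max (i.1 j : ℝ) 0 / M.p j := by
  have hmono (j : Fin J) : 0 ≤ max (i.1 j : ℝ) 0 - max ((i.1 j : ℝ) - 1) 0 :=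
    sub_nonneg.2 (max_le_max_right 0 (sub_le_self _ zero_le_one))
  obtain ⟨j, hj⟩ : ∃ j, 0 < i.1 j := by simpa [emptyStates] using hi
  have hloss : 1 ≤ max (i.1 j : ℝ) 0 - max ((i.1 j : ℝ) - 1) 0 := by
    have : (1 : ℝ) ≤ i.1 j := mod_cast hj
    rw [max_eq_left (by linarith), max_eq_left (by linarith), sub_sub_cancel]
  have hsum := hloss.trans (Finset.single_le_sum (fun j _ => hmono j) (Finset.mem_univ j))
  rw [demandOp_apply_of_dec (sum_dec (fun j x => max (x : ℝ) 0 / M.p j) i), add_assoc]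
  refine add_le_of_nonpos_right ?_
  simp only [← sub_div, mul_div_cancel₀ _ (p_pos _).ne', Int.cast_sub, Int.cast_one]
  rw [← neg_le_neg_iff, neg_zero, neg_add, ← Finset.sum_neg_distrib]
  simpa using hsum

theorem admissible_of_emptyStates_subset (hU : M.emptyStates ⊆ U) (hfull : M.full ∉ U) :
    M.Admissible U :=
  admissible_iff.2 ⟨hfull, isMarkovOperator_demandOp.summable_killedMean_one
    (fun _ => Finset.sum_nonneg fun j _ => div_nonneg (le_max_right _ _) (p_pos j).le)
    fun _ hi => demandOp_sum_max_div_p_add_one_le fun h => hi (hU h)⟩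

theorem admissible_emptyStates : M.Admissible M.emptyStates :=
  admissible_of_emptyStates_subset subset_rfl full_notMem_emptyStates

theorem admissible_lookAhead {α : ℝ} (hfull : stockoutRate M.full ≤ α) (hα : α < M.maxRate) :
    M.Admissible (M.lookAhead α) :=
  admissible_of_emptyStates_subset
    (fun _ hi => sub_pos.2 (hα.trans_eq (stockoutRate_eq_maxRate hi).symm))
    fun h => (sub_pos.1 h).not_ge hfull

namespace Admissible

theorem cycleTime_pos (hU : M.Admissible U) : 0 < M.cycleTime U := by
  have hnonneg : (0 : M.State → ℝ) ≤ Uᶜ.indicator 1 :=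
    Set.indicator_nonneg fun _ _ => zero_le_one
  have hone := (isMarkovOperator_demandOp.summable_killedMean_one_iff.1 hU.summable).le_tsum 0
    fun l _ => isMarkovOperator_demandOp.killedMean_nonneg hnonneg l
  rw [killedMean_zero, Set.indicator_of_mem (by exact hU.1), Pi.one_apply] at hone
  exact add_pos_of_nonneg_of_pos M.τ_nonneg
    (mul_pos (inv_pos.2 totalRate_pos) (zero_lt_one.trans_le hone))

theorem tendsto_sum_killedMean_visitCost (hU : M.Admissible U) :
    Tendsto (fun m => ∑ l ∈ Finset.range m, killedMean M.demandOp U M.full l (M.visitCost U))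
      atTop (𝓝 (M.cycleCost U)) := by
  have hvisit : M.visitCost U = U.indicator M.stopCost := by
    ext i
    by_cases hi : i ∈ U <;> simp [visitCost, hi]
  have hdrift (i : M.State) :
      |(M.demandOp M.stopCost - M.stopCost) i| ≤ M.totalRate⁻¹ * M.maxRate := by
    rw [demandOp_stopCost_sub, Pi.smul_apply, smul_eq_mul,
      abs_of_nonneg (mul_nonneg (inv_nonneg.2 totalRate_pos.le) stockoutRate_nonneg)]
    exact mul_le_mul_of_nonneg_left stockoutRate_le_maxRate (inv_nonneg.2 totalRate_pos.le)
  have hlim := isMarkovOperator_demandOp.tendsto_sum_killedMean_indicator isClock_level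
    hU.summable abs_stopCost_le hdrift
  rwa [demandOp_stopCost_sub, occupation_smul, ← hvisit] at hlim

theorem tendsto_sum_killedMean_visitTime (hU : M.Admissible U) :
    Tendsto (fun m => ∑ l ∈ Finset.range m, killedMean M.demandOp U M.full l (M.visitTime U))
      atTop (𝓝 (M.cycleTime U)) := by
  have hvisit : M.visitTime U = M.τ • U.indicator 1 + M.totalRate⁻¹ • Uᶜ.indicator 1 := by
    ext i
    by_cases hi : i ∈ U <;> simp [visitTime, hi]
  have htrigger : Tendsto (fun m => ∑ l ∈ Finset.range m,
      killedMean M.demandOp U M.full l (U.indicator 1)) atTop (𝓝 1) := by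
    simpa [isMarkovOperator_demandOp.map_one, occupation] using
      isMarkovOperator_demandOp.tendsto_sum_killedMean_indicator isClock_level
        hU.summable (v := 1) (c := 1) (c' := 0) (d := 0) (by simp)
        (by simp [isMarkovOperator_demandOp.map_one])
  have hcontinue := (isMarkovOperator_demandOp.summable_killedMean_one_iff.1
    hU.summable).hasSum.tendsto_sum_nat
  simpa [hvisit, Finset.sum_add_distrib, ← Finset.mul_sum, cycleTime, occupation] using
    (htrigger.const_mul M.τ).add (hcontinue.const_mul M.totalRate⁻¹)

theorem tendsto_avgCostUpTo (hU : M.Admissible U) :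
    Tendsto (M.avgCostUpTo U) atTop (𝓝 (M.cycleCost U / M.cycleTime U)) := by
  have hmean (k : ℕ) (v : M.State → ℝ) : M.expect (M.law U k) v =
      killedMean (restart M.demandOp U M.full) ∅ M.full k v := pmfMean_law k v
  refine (isMarkovOperator_demandOp.tendsto_sum_restart_div_sum_restart hU.summable
    hU.tendsto_sum_killedMean_visitCost hU.tendsto_sum_killedMean_visitTime
    hU.cycleTime_pos.ne').congr fun m => ?_
  simp only [avgCostUpTo, hmean]

theorem avgCost_eq (hU : M.Admissible U) : M.avgCost U = M.cycleCost U / M.cycleTime U :=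
  hU.tendsto_avgCostUpTo.limsup_eq

theorem cycleCost_sub (hU : M.Admissible U) (α : ℝ) :
    M.cycleCost U - α * M.cycleTime U =
      M.stopCost M.full - α * M.τ +
        M.totalRate⁻¹ * occupation M.demandOp U M.full (excess α) := by
  have hexcess : excess α = stockoutRate + (-α) • (1 : M.State → ℝ) := by
    ext i
    simp [excess, sub_eq_add_neg]
  rw [hexcess, isMarkovOperator_demandOp.occupation_add hU.summable (c := M.maxRate) (c' := |α|)
    (fun i => (abs_of_nonneg stockoutRate_nonneg).trans_le stockoutRate_le_maxRate) (by simp),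
    occupation_smul, cycleCost, cycleTime]
  ring

theorem tendsto_sum_killedMean_leftover (hU : M.Admissible U) :
    Tendsto (fun m => ∑ l ∈ Finset.range m,
      killedMean M.demandOp U M.full l (U.indicator leftover)) atTop
      (𝓝 (M.cycleCost U - M.maxRate * M.cycleTime U - (M.A - ∑ j, M.b j * (M.Q j : ℝ)))) := by
  have hdrift (i : M.State) : |(M.demandOp leftover - leftover : M.State → ℝ) i| ≤
      M.totalRate⁻¹ * (M.maxRate + |M.maxRate|) := by
    rw [demandOp_leftover_sub, Pi.smul_apply, smul_eq_mul, abs_mul,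
      abs_of_pos (inv_pos.2 totalRate_pos)]
    exact mul_le_mul_of_nonneg_left (abs_excess_le M.maxRate i) (inv_pos.2 totalRate_pos).le
  have hlim := isMarkovOperator_demandOp.tendsto_sum_killedMean_indicator isClock_level
    hU.summable (v := leftover) (c := ∑ j, M.b j * (M.Q j : ℝ)) (c' := 0)
    (fun i => by simpa [abs_of_nonneg leftover_nonneg] using leftover_le) hdrift
  rw [demandOp_leftover_sub, occupation_smul, ← excess] at hlim
  convert hlim using 2
  have hsum : ∑ j, M.b j * (M.rate j * M.τ - (M.full.1 j : ℝ)) =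
      M.maxRate * M.τ - ∑ j, M.b j * (M.Q j : ℝ) := by
    rw [maxRate, Finset.sum_mul, ← Finset.sum_sub_distrib]
    exact Finset.sum_congr rfl fun j _ => by rw [full]; ring
  rw [hU.cycleCost_sub, stopCost_eq_add_leftover, hsum]
  ring

theorem sub_le_cycleCost_sub (hU : M.Admissible U) :
    M.A - ∑ j, M.b j * (M.Q j : ℝ) ≤ M.cycleCost U - M.maxRate * M.cycleTime U :=
  sub_nonneg.1 <| ge_of_tendsto' hU.tendsto_sum_killedMean_leftover fun _ =>
    Finset.sum_nonneg fun l _ => isMarkovOperator_demandOp.killedMean_nonneg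
      (Set.indicator_nonneg fun _ _ => leftover_nonneg) l

theorem stockoutRate_full_le_avgCost (hmin : M.minFixedCost ≤ M.A) (hU : M.Admissible U) :
    stockoutRate M.full ≤ M.avgCost U := by
  have hexcess : 0 ≤ excess (stockoutRate M.full) := fun i =>
    sub_nonneg.2 (stockoutRate_antitone i.2)
  have hoccupation := mul_nonneg (inv_nonneg.2 (totalRate_pos (M := M)).le)
    (isMarkovOperator_demandOp.occupation_nonneg (U := U) (o := M.full) hexcess)
  rw [hU.avgCost_eq, le_div_iff₀ hU.cycleTime_pos]
  linarith [hU.cycleCost_sub (stockoutRate M.full), stopCost_full (M := M)]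

end Admissible

theorem cycleCost_emptyStates_sub :
    M.cycleCost M.emptyStates - M.maxRate * M.cycleTime M.emptyStates =
      M.A - ∑ j, M.b j * (M.Q j : ℝ) := by
  have hzero : M.emptyStates.indicator leftover = 0 := by
    rw [Set.indicator_eq_zero']
    exact Set.disjoint_right.2 fun i hi h => h (leftover_eq_zero hi)
  have hlim := admissible_emptyStates.tendsto_sum_killedMean_leftover (M := M)
  simp only [hzero, map_zero, Finset.sum_const_zero] at hlim
  exact sub_eq_zero.1 (tendsto_nhds_unique hlim tendsto_const_nhds)

theorem avgCost_emptyStates_lt (hmax : M.A < ∑ j, M.b j * (M.Q j : ℝ)) :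
    M.avgCost M.emptyStates < M.maxRate := by
  rw [admissible_emptyStates.avgCost_eq, div_lt_iff₀ admissible_emptyStates.cycleTime_pos]
  linarith [cycleCost_emptyStates_sub (M := M)]

theorem stockoutRate_full_le_optCost (hmin : M.minFixedCost ≤ M.A) :
    stockoutRate M.full ≤ M.optCost :=
  le_csInf ⟨_, _, admissible_emptyStates, rfl⟩ <|
    Set.forall_mem_image.2 fun _ hU => hU.stockoutRate_full_le_avgCost hmin

theorem optCost_le (hmin : M.minFixedCost ≤ M.A) (hU : M.Admissible U) :
    M.optCost ≤ M.avgCost U :=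
  csInf_le ⟨stockoutRate M.full, Set.forall_mem_image.2 fun _ hV =>
    Admissible.stockoutRate_full_le_avgCost hmin hV⟩ ⟨U, hU, rfl⟩

theorem optCost_lt_maxRate (hmin : M.minFixedCost ≤ M.A)
    (hmax : M.A < ∑ j, M.b j * (M.Q j : ℝ)) : M.optCost < M.maxRate :=
  (optCost_le hmin admissible_emptyStates).trans_lt (avgCost_emptyStates_lt hmax)

theorem entranceFee_eq (i : M.State) :
    M.entranceFee i = M.totalRate⁻¹ * excess M.optCost i := by
  have hreward : M.stopReward = (M.optCost * M.τ) • 1 - M.stopCost := by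
    ext i
    simp only [stopReward, Pi.sub_apply, Pi.smul_apply, Pi.one_apply, smul_eq_mul]
    ring
  have hdrift := congrFun (demandOp_stopCost_sub (M := M)) i
  simp only [Pi.sub_apply, Pi.smul_apply, smul_eq_mul] at hdrift
  rw [entranceFee, ← demandOp_apply, hreward, map_sub, map_smul, isMarkovOperator_demandOp.map_one,
    contCost, one_div, excess, Pi.sub_apply, Pi.sub_apply, Pi.sub_apply, Function.const_apply]
  linarith

theorem entranceFee_pos_iff {i : M.State} : 0 < M.entranceFee i ↔ 0 < excess M.optCost i := by
  rw [entranceFee_eq, mul_pos_iff_of_pos_left (inv_pos.2 totalRate_pos)]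

theorem entranceFee_neg_iff {i : M.State} : M.entranceFee i < 0 ↔ excess M.optCost i < 0 := by
  rw [entranceFee_eq, ← smul_eq_mul, smul_neg_iff_of_pos_left (inv_pos.2 totalRate_pos)]

theorem setOf_entranceFee_pos : {i | 0 < M.entranceFee i} = M.lookAhead M.optCost :=
  Set.ext fun _ => entranceFee_pos_iff

theorem admissible_lookAhead_optCost (hmin : M.minFixedCost ≤ M.A)
    (hmax : M.A < ∑ j, M.b j * (M.Q j : ℝ)) : M.Admissible (M.lookAhead M.optCost) :=
  admissible_lookAhead (stockoutRate_full_le_optCost hmin) (optCost_lt_maxRate hmin hmax)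

theorem Admissible.summable_killedMean_excess (hU : M.Admissible U) (α : ℝ) :
    Summable fun l => killedMean M.demandOp U M.full l (Uᶜ.indicator (excess α)) :=
  isMarkovOperator_demandOp.summable_killedMean_indicator hU.summable (abs_excess_le α)

theorem killedMean_lookAhead_le (U : Set M.State) (α : ℝ) (l : ℕ) :
    killedMean M.demandOp (M.lookAhead α) M.full l ((M.lookAhead α)ᶜ.indicator (excess α)) ≤
      killedMean M.demandOp U M.full l (Uᶜ.indicator (excess α)) :=
  isMarkovOperator_demandOp.killedMean_pos_le (isAbsorbing_lookAhead α) l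

theorem Admissible.cycleCost_lookAhead_sub_le {α : ℝ} (hα : M.Admissible (M.lookAhead α))
    (hU : M.Admissible U) :
    M.cycleCost (M.lookAhead α) - α * M.cycleTime (M.lookAhead α) ≤
      M.cycleCost U - α * M.cycleTime U := by
  rw [hα.cycleCost_sub, hU.cycleCost_sub]
  refine add_le_add_right (mul_le_mul_of_nonneg_left ?_ (inv_nonneg.2 totalRate_pos.le)) _
  exact (hα.summable_killedMean_excess α).tsum_le_tsum (killedMean_lookAhead_le U α)
    (hU.summable_killedMean_excess α)

theorem avgCost_lookAhead_optCost (hmin : M.minFixedCost ≤ M.A)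
    (hmax : M.A < ∑ j, M.b j * (M.Q j : ℝ)) :
    M.avgCost (M.lookAhead M.optCost) = M.optCost := by
  have hL := admissible_lookAhead_optCost hmin hmax
  refine (optCost_le hmin hL).antisymm' (not_lt.1 fun hlt => ?_)
  obtain ⟨γ, hγ, hle⟩ := exists_lt_forall_le_div
    (c := fun V : {V // M.Admissible V} => M.cycleCost V) (t := fun V => M.cycleTime V)
    (fun V => V.2.cycleTime_pos) (optCost_lt_maxRate hmin hmax) (sub_nonneg.2 hmax.le)
    (sub_pos.2 ((lt_div_iff₀ hL.cycleTime_pos).1 (hlt.trans_eq hL.avgCost_eq)))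
    (fun V => (neg_sub _ _).trans_le V.2.sub_le_cycleCost_sub)
    fun V => hL.cycleCost_lookAhead_sub_le V.2
  refine hγ.not_ge (le_csInf ⟨_, _, admissible_emptyStates, rfl⟩ ?_)
  exact Set.forall_mem_image.2 fun V hV => (hle ⟨V, hV⟩).trans_eq hV.avgCost_eq.symm

theorem isOptimal_lookAhead_optCost (hmin : M.minFixedCost ≤ M.A)
    (hmax : M.A < ∑ j, M.b j * (M.Q j : ℝ)) : M.IsOptimal (M.lookAhead M.optCost) :=
  ⟨admissible_lookAhead_optCost hmin hmax, fun _ hV =>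
    (avgCost_lookAhead_optCost hmin hmax).trans_le (optCost_le hmin hV)⟩

theorem IsOptimal.cycleCost_sub_optCost (hmin : M.minFixedCost ≤ M.A)
    (hmax : M.A < ∑ j, M.b j * (M.Q j : ℝ)) (hU : M.IsOptimal U) :
    M.cycleCost U - M.optCost * M.cycleTime U = 0 := by
  have havg : M.avgCost U = M.optCost := (optCost_le hmin hU.1).antisymm' <|
    (hU.2 _ (admissible_lookAhead_optCost hmin hmax)).trans_eq
      (avgCost_lookAhead_optCost hmin hmax)
  rw [← havg, hU.1.avgCost_eq, div_mul_cancel₀ _ hU.1.cycleTime_pos.ne', sub_self]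

theorem IsOptimal.killedMean_eq (hmin : M.minFixedCost ≤ M.A)
    (hmax : M.A < ∑ j, M.b j * (M.Q j : ℝ)) (hU : M.IsOptimal U) (l : ℕ) :
    killedMean M.demandOp (M.lookAhead M.optCost) M.full l
        ((M.lookAhead M.optCost)ᶜ.indicator (excess M.optCost)) =
      killedMean M.demandOp U M.full l (Uᶜ.indicator (excess M.optCost)) := by
  have hL := isOptimal_lookAhead_optCost hmin hmax
  have hcost := (hL.cycleCost_sub_optCost hmin hmax).trans
    (hU.cycleCost_sub_optCost hmin hmax).symm
  rw [hL.1.cycleCost_sub, hU.1.cycleCost_sub] at hcost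
  have htotal := mul_left_cancel₀ (inv_pos.2 (totalRate_pos (M := M))).ne'
    (add_left_cancel hcost)
  by_contra hne
  exact htotal.not_lt <| Summable.tsum_lt_tsum (killedMean_lookAhead_le U M.optCost)
    ((killedMean_lookAhead_le U M.optCost l).lt_of_ne hne)
    (hL.1.summable_killedMean_excess _) (hU.1.summable_killedMean_excess _)

theorem IsOptimal.mem_of_entranceFee (hmin : M.minFixedCost ≤ M.A)
    (hmax : M.A < ∑ j, M.b j * (M.Q j : ℝ)) (hU : M.IsOptimal U) {i : M.State} {k : ℕ}
    (hi : i ∈ (M.law U k).support) :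
    (M.entranceFee i < 0 → i ∈ Uᶜ) ∧ (0 < M.entranceFee i → i ∈ U) := by
  rw [entranceFee_neg_iff, entranceFee_pos_iff]
  obtain ⟨l, hl⟩ := exists_killedMean_pos_of_mem_support hi
  exact isMarkovOperator_demandOp.sign_of_killedMean_eq (isAbsorbing_lookAhead M.optCost)
    (hU.killedMean_eq hmin hmax l) hl

end Optimality

end VendingModel

end

theorem corollary1 {J : ℕ} [NeZero J] (M : VendingModel J)
    (hmin : M.minFixedCost ≤ M.A) (hmax : M.A < ∑ j, M.b j * (M.Q j : ℝ)) :
    -- the trigger set `{f' > 0}`, whose continue set is `{f' ≤ 0}`, is optimal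
    (∃ U : Set M.State, M.IsOptimal U ∧
      Uᶜ = {i | M.entranceFee i ≤ 0} ∧ U = {i | 0 < M.entranceFee i} ∧
      Tendsto (M.avgCostUpTo U) atTop (𝓝 M.optCost)) ∧
    -- any optimal trigger set agrees with it on all visited states, up to ties `f' = 0`
    (∀ U : Set M.State, M.IsOptimal U → ∀ i : M.State, (∃ k, i ∈ (M.law U k).support) →
      (M.entranceFee i < 0 → i ∈ Uᶜ) ∧ (0 < M.entranceFee i → i ∈ U)) := by
  have hopt := VendingModel.isOptimal_lookAhead_optCost hmin hmax
  have hlim := hopt.1.tendsto_avgCostUpTo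
  rw [← hopt.1.avgCost_eq, VendingModel.avgCost_lookAhead_optCost hmin hmax] at hlim
  refine ⟨⟨M.lookAhead M.optCost, hopt, ?_, VendingModel.setOf_entranceFee_pos.symm, hlim⟩,
    fun U hU i ⟨k, hi⟩ => hU.mem_of_entranceFee hmin hmax hi⟩
  simp only [← VendingModel.setOf_entranceFee_pos, Set.compl_ofPred, not_lt]
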